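/- Let $K$ be a field of characteristic zero, let $L/K$ be a finite extension with Galois closure $E/K$, and put $G=\mathrm{Gal}(E/K)$, $G_L=\mathrm{Gal}(E/L)$, $X=G/G_L$ (left cosets). Let $\lambda:G\to\mathrm{Perm}(X)$ be left translation. Let $N$ be a group and let $\alpha_1,\alpha_2:N\hookrightarrow\mathrm{Perm}(X)$ be injective homomorphisms whose images are regular (transitive on $X$ and of order $|X|$) and normalized by $\lambda(G)$. Let $G$ act on $\alpha_i(N)$ by $g\ast\eta=\lambda(g)\eta\lambda(g)^{-1}$, and let $E[\alpha_i(N)]^G$ be the $K$-algebra of elements of the group algebra $E[\alpha_i(N)]$ fixed by $G$, where $G$ acts simultaneously on $E$ by Galois automorphisms and on $\alpha_i(N)$ by $\ast$. Let $\mathrm{Hol}(N)=\rho(N)\rtimes\mathrm{Aut}(N)$ be the holomorph, that is, the normalizer in $\mathrm{Perm}(N)$ of the left translations, with $\rho$ the right regular representation. Let $\beta_i:G\to\mathrm{Hol}(N)$ be the homomorphism corresponding to $\alpha_i$ under Byott's translation: $\beta_i(g)=a_i^{-1}\lambda(g)a_i$, where $a_i:N\to X$ is the bijection $\eta\mapsto\alpha_i(\eta)(\overline{1})$.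 Let $\overline{\beta_i}:G\to\mathrm{Aut}(N)$ be its composition with the projection onto the automorphism component, and let $G$ act on $N$ by $g\ast_i\eta=\overline{\beta_i}(g)[\eta]$. Let $\tilde E$ be the compositum of $E$ and $K(\zeta_e)$, where $e$ is the exponent of $N$ and $\zeta_e$ is a primitive $e$-th root of unity, and let $\Gamma=\mathrm{Gal}(\tilde E/K)$. Regard all the above actions of $G$ on $\alpha_i(N)$ and $N$ as actions of $\Gamma$ through the restriction map $\Gamma\to G$. If $\Gamma$ acts on a group $M$ by automorphisms, let it act on the set $\widehat M$ of characters $\chi:M\to\tilde E^\times$ by $(\gamma\ast\chi)[\eta]=\gamma(\chi[\gamma^{-1}\ast\eta])$; the resulting actions on $\widehat{\alpha_i(N)}$ and $\widehat N$ are again denoted $\ast$ and $\ast_i$. Suppose that $N$ is cyclic and that $K$ contains a primitive $|N|$-th root of unity. Then the following are equivalent: 1. $E[\alpha_1(N)]^G\cong E[\alpha_2(N)]^G$ as $K$-algebras; 2. $(\widehat{\alpha_1(N)},\ast)\cong(\widehat{\alpha_2(N)},\ast)$ as $\Gamma$-sets; 3. $(\widehat N,\ast_1)\cong(\widehat N,\ast_2)$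 as $\Gamma$-sets; 4. $(\alpha_1(N),\ast)\cong(\alpha_2(N),\ast)$ as $\Gamma$-sets; 5. $(N,\ast_1)\cong(N,\ast_2)$ as $\Gamma$-sets. Here an isomorphism of $\Gamma$-sets is a $\Gamma$-equivariant bijection. -/

import Mathlib

namespace HopfGalois

noncomputable section

/-! ### Isomorphism of `Γ`-sets and of groups with an action -/

/-- A `Γ`-set is given by the homomorphism from `Γ` to the permutations of the underlying set.
Two `Γ`-sets are isomorphic if there is a `Γ`-equivariant bijection between them. -/
def GSetIso {Γ A B : Type*} [Group Γ] (a : Γ →* Equiv.Perm A) (b : Γ →* Equiv.Perm B) : Prop :=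
  ∃ f : A ≃ B, ∀ (γ : Γ) (x : A), f (a γ x) = b γ (f x)

/-- The `Γ`-set underlying a `Γ`-group `(N, θ)`, where `θ : Γ →* MulAut N` is an action of `Γ`
on the group `N` via automorphisms. -/
def toGSet {Γ N : Type*} [Group Γ] [Group N] (θ : Γ →* MulAut N) : Γ →* Equiv.Perm N :=
  (MulAut.toPerm N).comp θ

/-- For a group `N` on which `Gal(F/K)` acts via `θ`, the map `χ ↦ γ ∗ χ` on characters
`N →* Fˣ` given by `(γ ∗ χ)(η) = γ (χ (γ⁻¹ ∗ η))`. -/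
def dualMap {K F N : Type*} [Field K] [Field F] [Algebra K F] [Group N]
    (θ : (F ≃ₐ[K] F) →* MulAut N) (γ : F ≃ₐ[K] F) (χ : N →* Fˣ) : N →* Fˣ :=
  (Units.map (γ : F →* F)).comp (χ.comp (θ γ⁻¹).toMonoidHom)

theorem dualMap_one {K F N : Type*} [Field K] [Field F] [Algebra K F] [Group N]
    (θ : (F ≃ₐ[K] F) →* MulAut N) (χ : N →* Fˣ) : dualMap θ 1 χ = χ := by
  ext η
  simp [dualMap]

theorem dualMap_mul {K F N : Type*} [Field K] [Field F] [Algebra K F] [Group N]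
    (θ : (F ≃ₐ[K] F) →* MulAut N) (γ δ : F ≃ₐ[K] F) (χ : N →* Fˣ) :
    dualMap θ (γ * δ) χ = dualMap θ γ (dualMap θ δ χ) := by
  ext η
  simp [dualMap]

/-- The dual action of `Gal(F/K)` on the characters `N →* Fˣ` of `N`,
`(γ ∗ χ)(η) = γ (χ (γ⁻¹ ∗ η))`. -/
def dualAction {K F N : Type*} [Field K] [Field F] [Algebra K F] [Group N]
    (θ : (F ≃ₐ[K] F) →* MulAut N) : (F ≃ₐ[K] F) →* Equiv.Perm (N →* Fˣ) where
  toFun γ :=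
    { toFun := dualMap θ γ
      invFun := dualMap θ γ⁻¹
      left_inv := fun χ => by rw [← dualMap_mul, inv_mul_cancel, dualMap_one]
      right_inv := fun χ => by rw [← dualMap_mul, mul_inv_cancel, dualMap_one] }
  map_one' := Equiv.ext (dualMap_one θ)
  map_mul' γ δ := Equiv.ext (dualMap_mul θ γ δ)

theorem dualAction_apply {K F N : Type*} [Field K] [Field F] [Algebra K F] [Group N]
    (θ : (F ≃ₐ[K] F) →* MulAut N) (γ : F ≃ₐ[K] F) (χ : N →* Fˣ) (η : N) :
    ((dualAction θ γ χ η : Fˣ) : F) = γ ((χ (θ γ⁻¹ η) : Fˣ) : F) := rfl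

/-! ### The fixed ring `E[N]^G` -/

/-- The simultaneous action of `G = Gal(E/K)` on `E[N]`: by Galois automorphisms on the
coefficients, and by `θ` on the group `N`. -/
def groupAlgebraAction {K E N : Type*} [Field K] [Field E] [Algebra K E] [Group N]
    (θ : (E ≃ₐ[K] E) →* MulAut N) (g : E ≃ₐ[K] E) :
    MonoidAlgebra E N →ₐ[K] MonoidAlgebra E N :=
  (MonoidAlgebra.mapDomainAlgHom K E (θ g).toMonoidHom).comp
    (MonoidAlgebra.mapAlgHom N (g : E →ₐ[K] E))

theorem groupAlgebraAction_single {K E N : Type*} [Field K] [Field E] [Algebra K E] [Group N]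
    (θ : (E ≃ₐ[K] E) →* MulAut N) (g : E ≃ₐ[K] E) (η : N) (c : E) :
    groupAlgebraAction θ g (MonoidAlgebra.single η c) = MonoidAlgebra.single (θ g η) (g c) := by
  simp [groupAlgebraAction]

/-- The `K`-algebra `E[N]^G` of elements of `E[N]` fixed by `G = Gal(E/K)`. -/
def fixedAlgebra {K E N : Type*} [Field K] [Field E] [Algebra K E] [Group N]
    (θ : (E ≃ₐ[K] E) →* MulAut N) : Subalgebra K (MonoidAlgebra E N) where
  carrier := {x | ∀ g : E ≃ₐ[K] E, groupAlgebraAction θ g x = x}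
  mul_mem' := by
    intro a b ha hb g
    rw [map_mul, ha g, hb g]
  add_mem' := by
    intro a b ha hb g
    rw [map_add, ha g, hb g]
  algebraMap_mem' := by
    intro r g
    exact AlgHom.commutes _ r

/-! ### The holomorph -/

/-- The left regular representation `λ : N → Perm(N)`. -/
def leftReg (N : Type*) [Group N] : N →* Equiv.Perm N := MulAction.toPermHom N N

/-- The right regular representation `ρ : N → Perm(N)`, `ρ(n)(x) = x n⁻¹`. -/
def rightReg (N : Type*) [Group N] : N →* Equiv.Perm N where
  toFun n := Equiv.mulRight n⁻¹
  map_one' := by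
    ext x
    simp
  map_mul' m n := by
    ext x
    simp [mul_assoc]

/-- The holomorph `Hol(N)`: the normalizer of `λ(N)` in `Perm(N)`. -/
def Hol (N : Type*) [Group N] : Subgroup (Equiv.Perm N) :=
  Subgroup.normalizer ((leftReg N).range : Set (Equiv.Perm N))

theorem hol_apply_mul {N : Type*} [Group N] {h : Equiv.Perm N} (hh : h ∈ Hol N) (x y : N) :
    h (x * y) = h x * (h 1)⁻¹ * h y := by
  have h1 : leftReg N x ∈ (leftReg N).range := ⟨x, rfl⟩
  obtain ⟨z, hz⟩ := (Subgroup.mem_normalizer_iff.mp hh (leftReg N x)).mp h1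
  have key : ∀ w, h (x * w) = z * h w := by
    intro w
    have := congrArg (fun p : Equiv.Perm N => p (h w)) hz
    simpa [leftReg] using this.symm
  have hx : h x = z * h 1 := by simpa using key 1
  rw [key y, hx]
  group

/-- The projection `Hol(N) = ρ(N) ⋊ Aut(N) → Aut(N)` onto the automorphism component; see
`hol_decomposition` and `holProj_unique`. -/
def holProj (N : Type*) [Group N] : Hol N →* MulAut N where
  toFun h :=
    { toEquiv := h.1.trans (Equiv.mulRight (h.1 1)⁻¹)
      map_mul' := by
        intro x y
        simp [hol_apply_mul h.2 x y, mul_assoc] }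
  map_one' := by
    ext x
    simp
  map_mul' := by
    intro a b
    ext x
    have h1 := hol_apply_mul a.2 (b.1 x * (b.1 1)⁻¹) (b.1 1)
    simp only [inv_mul_cancel_right] at h1
    simp [h1]

theorem hol_decomposition {N : Type*} [Group N] (h : Hol N) :
    ∃ n : N, (h : Equiv.Perm N) = rightReg N n * MulAut.toPerm N (holProj N h) := by
  refine ⟨(h.1 1)⁻¹, ?_⟩
  ext x
  have e : MulAut.toPerm N (holProj N h) x = h.1 x * (h.1 1)⁻¹ := rfl
  simp [rightReg, e]

theorem holProj_unique {N : Type*} [Group N] (h : Hol N) (n : N) (θ : MulAut N)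
    (e : (h : Equiv.Perm N) = rightReg N n * MulAut.toPerm N θ) : holProj N h = θ := by
  have t : ∀ y, MulAut.toPerm N θ y = θ y := fun _ => rfl
  ext x
  simp [holProj, e, rightReg, t]

/-! ### Regular subgroups of `Perm(X)` normalized by `λ(G)`, and Byott's translation

Throughout `E / K` is a field extension with group `G = Gal(E/K)` and `L` is an intermediate
field, with `G_L = Gal(E/L)`. -/

/-- The left coset space `X = G / G_L`. -/
abbrev Cosets {K E : Type*} [Field K] [Field E] [Algebra K E] (L : IntermediateField K E) :
    Type _ :=
  (E ≃ₐ[K] E) ⧸ L.fixingSubgroup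

/-- The homomorphism `λ : G → Perm(X)` given by left translation of cosets. -/
def cosetTranslation {K E : Type*} [Field K] [Field E] [Algebra K E]
    (L : IntermediateField K E) : (E ≃ₐ[K] E) →* Equiv.Perm (Cosets L) :=
  MulAction.toPermHom (E ≃ₐ[K] E) (Cosets L)

/-- A subgroup of `Perm(X)` is regular if it has the same size as `X` and is transitive on `X`
(`X` is finite where this is used). -/
def IsRegularSubgroup {X : Type*} (M : Subgroup (Equiv.Perm X)) : Prop :=
  Nat.card M = Nat.card X ∧ MulAction.IsPretransitive M X

/-- An embedding `α : N ↪ Perm(X)` whose image is regular and normalized by `λ(G)`. -/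
structure RegularEmbedding {K E : Type*} [Field K] [Field E] [Algebra K E]
    (L : IntermediateField K E) (N : Type*) [Group N] where
  /-- the underlying homomorphism -/
  hom : N →* Equiv.Perm (Cosets L)
  injective : Function.Injective hom
  regular : IsRegularSubgroup hom.range
  normalized : (cosetTranslation L).range ≤
    Subgroup.normalizer (hom.range : Set (Equiv.Perm (Cosets L)))

namespace RegularEmbedding

variable {K E : Type*} [Field K] [Field E] [Algebra K E] {L : IntermediateField K E}
  {N : Type*} [Group N]

/-- The group `α(N)`. -/
abbrev image (α : RegularEmbedding L N) : Subgroup (Equiv.Perm (Cosets L)) := α.hom.range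

/-- The action `∗` of `G` on `α(N)`: `σ ∗ η = λ(σ) η λ(σ)⁻¹`. -/
def conjAction (α : RegularEmbedding L N) : (E ≃ₐ[K] E) →* MulAut α.image :=
  (Subgroup.normalizerMonoidHom α.image).comp
    ((cosetTranslation L).codRestrict _ fun g => α.normalized ⟨g, rfl⟩)

theorem conjAction_apply (α : RegularEmbedding L N) (g : E ≃ₐ[K] E) (η : α.image) :
    (α.conjAction g η : Equiv.Perm (Cosets L)) =
      cosetTranslation L g * η * (cosetTranslation L g)⁻¹ := rfl

theorem eval_bijective [FiniteDimensional K E] (α : RegularEmbedding L N) :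
    Function.Bijective fun η : N => α.hom η ((1 : E ≃ₐ[K] E) : Cosets L) := by
  have hs : Function.Surjective fun η : N => α.hom η ((1 : E ≃ₐ[K] E) : Cosets L) := by
    intro x
    obtain ⟨⟨_, η, rfl⟩, h⟩ :=
      α.regular.2.exists_smul_eq ((1 : E ≃ₐ[K] E) : Cosets L) x
    exact ⟨η, h⟩
  have hc : Nat.card N = Nat.card (Cosets L) :=
    (Nat.card_congr (MonoidHom.ofInjective α.injective).toEquiv).trans α.regular.1
  have : Finite N := Nat.finite_of_card_ne_zero (by rw [hc]; exact Nat.card_pos.ne')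
  exact (Nat.bijective_iff_surjective_and_card _).mpr ⟨hs, hc⟩

/-- The bijection `N → X`, `η ↦ α(η)(ē)`, where `ē` is the trivial coset. -/
def evalEquiv [FiniteDimensional K E] (α : RegularEmbedding L N) : N ≃ Cosets L :=
  Equiv.ofBijective _ α.eval_bijective

/-- For `a : N → X`, `a(η) = α(η)(ē)`, this is `g ↦ a⁻¹ λ(g) a`, a homomorphism
`G → Perm(N)`. -/
def translationPerm [FiniteDimensional K E] (α : RegularEmbedding L N) :
    (E ≃ₐ[K] E) →* Equiv.Perm N :=
  (α.evalEquiv.symm.permCongrHom.toMonoidHom).comp (cosetTranslation L)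

theorem translationPerm_apply [FiniteDimensional K E] (α : RegularEmbedding L N)
    (g : E ≃ₐ[K] E) (x : N) :
    α.translationPerm g x = α.evalEquiv.symm (cosetTranslation L g (α.evalEquiv x)) := rfl

theorem evalEquiv_mul [FiniteDimensional K E] (α : RegularEmbedding L N) (m x : N) :
    α.evalEquiv (m * x) = α.hom m (α.evalEquiv x) := by
  simp [evalEquiv]

theorem permCongr_leftReg [FiniteDimensional K E] (α : RegularEmbedding L N) (m : N) :
    α.evalEquiv.permCongrHom (leftReg N m) = α.hom m := by
  ext x
  simp [Equiv.permCongrHom, leftReg, evalEquiv_mul]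

theorem translationPerm_mem_hol [FiniteDimensional K E] (α : RegularEmbedding L N)
    (g : E ≃ₐ[K] E) : α.translationPerm g ∈ Hol N := by
  have hg : α.evalEquiv.permCongrHom (α.translationPerm g) = cosetTranslation L g := by
    ext x
    simp [Equiv.permCongrHom, translationPerm_apply]
  have hr : ∀ p : Equiv.Perm N, p ∈ (leftReg N).range ↔
      α.evalEquiv.permCongrHom p ∈ α.hom.range := by
    intro p
    constructor
    · rintro ⟨m, rfl⟩
      exact ⟨m, (α.permCongr_leftReg m).symm⟩
    · rintro ⟨m, hm⟩
      exact ⟨m, α.evalEquiv.permCongrHom.injective ((α.permCongr_leftReg m).trans hm)⟩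
  refine Subgroup.mem_normalizer_iff.mpr fun p => ?_
  have hn := Subgroup.mem_normalizer_iff.mp (α.normalized ⟨g, rfl⟩)
    (α.evalEquiv.permCongrHom p)
  rw [hr, hr, map_mul, map_mul, map_inv, hg]
  exact hn

/-- The homomorphism `β : G → Hol(N)` corresponding to `α` under Byott's translation. -/
def beta [FiniteDimensional K E] (α : RegularEmbedding L N) : (E ≃ₐ[K] E) →* Hol N :=
  α.translationPerm.codRestrict (Hol N) α.translationPerm_mem_hol

/-- The composition `G → Hol(N) → Aut(N)` of `β` with the projection onto the automorphism
component. It gives the action `g ∗_α η = β̄(g)[η]` of `G` on `N`. -/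
def betaBar [FiniteDimensional K E] (α : RegularEmbedding L N) : (E ≃ₐ[K] E) →* MulAut N :=
  (holProj N).comp α.beta

end RegularEmbedding

/-! ### Extension to `Γ = Gal(Ẽ/K)` -/

/-- For `K ⊆ E ⊆ F` with `E / K` normal, an action of `Gal(E/K)` on a group, viewed as an action
of `Gal(F/K)` through restriction to `E`. -/
def inflate {K E : Type*} (F : Type*) {N : Type*} [Field K] [Field E] [Field F] [Algebra K E]
    [Algebra K F] [Algebra E F] [IsScalarTower K E F] [Normal K E] [Group N]
    (θ : (E ≃ₐ[K] E) →* MulAut N) : (F ≃ₐ[K] F) →* MulAut N :=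
  θ.comp (AlgEquiv.restrictNormalHom E)

end

end HopfGalois

/-!
The `K`-algebra `E[M]^G` is a form of `E[M]`: by Galois descent it becomes `E[M]` after scalar
extension to `E`. Hence its `K`-algebra homomorphisms to `E` are the characters of `M`, and the
`G`-set they form determines `E[M]^G` up to isomorphism: if `M` has as many characters as elements,
then evaluation at all characters identifies `E[M]` with the functions `M̂ → E`, and `E[M]^G` with
the equivariant ones.

If `M` is cyclic and `K` contains the relevant roots of unity, the characters of `M` take values in
`K`, and automorphisms of `M` are power maps, so any isomorphism `M ≃ M̂` turns the action of `γ⁻¹`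
on `M` into the dual action of `γ` on `M̂`. As an equivariant bijection for the actions of all `γ⁻¹`
is one for the actions of all `γ`, the `Γ`-sets attached to two such groups are isomorphic if and
only if the dual ones are. Finally, Byott's translation is conjugation by the bijection `N → X`,
which carries the action on `N` to the action on `α(N)`.
-/

namespace HopfGalois

noncomputable section

section GSets

variable {Γ Δ A B C D : Type*} [Group Γ] [Group Δ] {a : Γ →* Equiv.Perm A}
  {b : Γ →* Equiv.Perm B} {c : Γ →* Equiv.Perm C} {d : Γ →* Equiv.Perm D}

theorem GSetIso.symm (h : GSetIso a b) : GSetIso b a := by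
  obtain ⟨f, hf⟩ := h
  exact ⟨f.symm, fun γ x => f.symm_apply_eq.mpr (by rw [hf, f.apply_symm_apply])⟩

theorem GSetIso.trans (h : GSetIso a b) (h' : GSetIso b c) : GSetIso a c := by
  obtain ⟨⟨f, hf⟩, ⟨k, hk⟩⟩ := h, h'
  exact ⟨f.trans k, fun γ x => by simp only [Equiv.trans_apply, hf, hk]⟩

theorem GSetIso.congr (hac : GSetIso a c) (hbd : GSetIso b d) : GSetIso a b ↔ GSetIso c d :=
  ⟨fun h => hac.symm.trans (h.trans hbd), fun h => hac.trans (h.trans hbd.symm)⟩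

theorem GSetIso.comp_iff {φ : Δ →* Γ} (hφ : Function.Surjective φ) :
    GSetIso (a.comp φ) (b.comp φ) ↔ GSetIso a b :=
  exists_congr fun f =>
    (hφ.forall (p := fun γ => ∀ x, f (a γ x) = b γ (f x))).symm

theorem GSetIso.congr_inv (e : A ≃ C) (e' : B ≃ D) (he : ∀ (γ : Γ) x, c γ (e x) = e (a γ⁻¹ x))
    (he' : ∀ (γ : Γ) x, d γ (e' x) = e' (b γ⁻¹ x)) : GSetIso a b ↔ GSetIso c d := by
  refine (e.equivCongr e').exists_congr fun f => ?_
  rw [(Equiv.inv Γ).surjective.forall]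
  refine forall_congr' fun γ => ?_
  rw [e.surjective.forall]
  simp [he, he']

end GSets

section GaloisDescent

open scoped TensorProduct

variable {K E V : Type*} [Field K] [Field E] [Algebra K E] [AddCommGroup V] [Module K V]
  [Module E V]

/-- A `K`-linear action `ρ` of `Gal(E/K)` on an `E`-vector space is semilinear if scalars pass
through `ρ g` by way of `g`. Such an action is a descent datum from `E` to `K`. -/
def IsSemilinear (ρ : Representation K (E ≃ₐ[K] E) V) : Prop :=
  ∀ (g : E ≃ₐ[K] E) (c : E) (v : V), ρ g (c • v) = g c • ρ g v

theorem linearIndependent_algEquiv (K E : Type*) [Field K] [Field E] [Algebra K E] :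
    LinearIndependent E fun (g : E ≃ₐ[K] E) (c : E) => g c :=
  (linearIndependent_monoidHom E E).comp (fun g : E ≃ₐ[K] E => (g : E →* E))
    fun _ _ h => AlgEquiv.ext fun c => DFunLike.congr_fun h c

namespace IsSemilinear

variable {ρ : Representation K (E ≃ₐ[K] E) V}

theorem norm_smul [Fintype (E ≃ₐ[K] E)] (hρ : IsSemilinear ρ) (c : E) (v : V) :
    ρ.norm (c • v) = ∑ g, g c • ρ g v := by
  simp only [Representation.norm, LinearMap.sum_apply, hρ _ c v]

theorem span_invariants_eq_top [FiniteDimensional K E] (hρ : IsSemilinear ρ) :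
    Submodule.span E (ρ.invariants : Set V) = ⊤ := by
  by_contra hspan
  obtain ⟨f, hf, hker⟩ := Submodule.exists_le_ker_of_lt_top _ (lt_top_iff_ne_top.mpr hspan)
  refine hf (LinearMap.ext fun v => ?_)
  have hsum (c : E) : ∑ g : E ≃ₐ[K] E, f (ρ g v) • g c = 0 := by
    have hmem : ρ.norm (c • v) ∈ ρ.invariants := fun g => ρ.self_norm_apply g _
    simpa [hρ.norm_smul, mul_comm] using hker (Submodule.subset_span hmem)
  have hzero := Fintype.linearIndependent_iff.mp (linearIndependent_algEquiv K E)
    (fun g => f (ρ g v)) (funext fun c => by simpa using hsum c) 1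
  simpa using hzero

theorem norm_smul_of_mem_invariants [FiniteDimensional K E] [IsGalois K E] [IsScalarTower K E V]
    (hρ : IsSemilinear ρ) (c : E) {v : V} (hv : v ∈ ρ.invariants) :
    ρ.norm (c • v) = Algebra.trace K E c • v := by
  rw [hρ.norm_smul, ← algebraMap_smul E (Algebra.trace K E c), trace_eq_sum_automorphisms,
    Finset.sum_smul]
  exact Finset.sum_congr rfl fun g _ => by rw [hv g]

theorem liftBaseChange_invariants_injective [FiniteDimensional K E] [IsGalois K E]
    [IsScalarTower K E V] (hρ : IsSemilinear ρ) :
    Function.Injective (ρ.invariants.subtype.liftBaseChange E) := by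
  rw [injective_iff_map_eq_zero]
  intro t ht
  let b := Module.finBasis K E
  obtain ⟨v, rfl⟩ := TensorProduct.eq_repr_basis_left b t
  rw [Finsupp.sum_fintype _ _ fun _ => TensorProduct.tmul_zero _ _] at ht ⊢
  have hsum : ∑ j, b j • (v j : V) = 0 := by simpa using ht
  have hv (i) : v i = 0 := by
    -- Multiplying by the trace-dual basis vector and averaging isolates the coefficient `v i`.
    have hnorm : ρ.norm (b.traceDual i • ∑ j, b j • (v j : V)) = v i := by
      simp [Finset.smul_sum, smul_smul, hρ.norm_smul_of_mem_invariants,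
        Module.Basis.trace_traceDual_mul, ite_smul]
    exact Subtype.ext (by simpa [hsum] using hnorm.symm)
  simp [hv]

theorem liftBaseChange_invariants_surjective [FiniteDimensional K E] [IsScalarTower K E V]
    (hρ : IsSemilinear ρ) : Function.Surjective (ρ.invariants.subtype.liftBaseChange E) := by
  rw [← LinearMap.range_eq_top, ← top_le_iff, ← hρ.span_invariants_eq_top, Submodule.span_le]
  exact fun v hv => ⟨1 ⊗ₜ ⟨v, hv⟩, by simp⟩

theorem isBaseChange_invariants [FiniteDimensional K E] [IsGalois K E] [IsScalarTower K E V]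
    (hρ : IsSemilinear ρ) : IsBaseChange E ρ.invariants.subtype := by
  have hbij : Function.Bijective (ρ.invariants.subtype.liftBaseChange E) :=
    ⟨hρ.liftBaseChange_invariants_injective, hρ.liftBaseChange_invariants_surjective⟩
  exact .of_equiv (LinearEquiv.ofBijective _ hbij) fun v => by simp

end IsSemilinear

end GaloisDescent

section Characters

variable {K E M : Type*} [Field K] [Field E] [Algebra K E] [Group M]

/-- The `E`-algebra homomorphism `E[M] → E` that extends a character of `M` linearly. -/
def charEval (χ : M →* Eˣ) : MonoidAlgebra E M →ₐ[E] E :=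
  MonoidAlgebra.lift E E M ((Units.coeHom E).comp χ)

theorem charEval_single (χ : M →* Eˣ) (x : M) (c : E) :
    charEval χ (MonoidAlgebra.single x c) = c * χ x := by
  simp [charEval]

theorem charEval_bijective (E M : Type*) [Field E] [Group M] :
    Function.Bijective (charEval : (M →* Eˣ) → MonoidAlgebra E M →ₐ[E] E) := by
  refine (MonoidAlgebra.lift E E M).bijective.comp ⟨fun χ χ' h => ?_, fun f => ?_⟩
  · ext x
    exact DFunLike.congr_fun h x
  · exact ⟨f.toHomUnits, by ext; simp⟩

theorem charEval_dualAction (θ : (E ≃ₐ[K] E) →* MulAut M) (g : E ≃ₐ[K] E) (χ : M →* Eˣ)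
    (x : MonoidAlgebra E M) :
    charEval (dualAction θ g χ) (groupAlgebraAction θ g x) = g (charEval χ x) := by
  induction x using MonoidAlgebra.induction_linear with
  | zero => simp only [map_zero]
  | add x y hx hy => simp only [map_add, hx, hy]
  | single η c =>
    rw [groupAlgebraAction_single, charEval_single, charEval_single, dualAction_apply,
      ← MulAut.mul_apply, ← map_mul, ← map_mul, inv_mul_cancel, map_one, MulAut.one_apply]

end Characters

section FixedAlgebra

open scoped TensorProduct

variable {K E M M' : Type*} [Field K] [Field E] [Algebra K E] [Group M] [Group M']

theorem groupAlgebraAction_one (θ : (E ≃ₐ[K] E) →* MulAut M) :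
    groupAlgebraAction θ 1 = AlgHom.id K _ := by
  ext x <;> simp [groupAlgebraAction_single]

theorem groupAlgebraAction_mul (θ : (E ≃ₐ[K] E) →* MulAut M) (g h : E ≃ₐ[K] E) :
    groupAlgebraAction θ (g * h) = (groupAlgebraAction θ g).comp (groupAlgebraAction θ h) := by
  ext x <;> simp [groupAlgebraAction_single]

/-- The simultaneous action of `Gal(E/K)` on `E[M]` as a `K`-linear representation, whose
invariants are `fixedAlgebra θ`. -/
def groupAlgebraRep (θ : (E ≃ₐ[K] E) →* MulAut M) :
    Representation K (E ≃ₐ[K] E) (MonoidAlgebra E M) where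
  toFun g := (groupAlgebraAction θ g).toLinearMap
  map_one' := by rw [groupAlgebraAction_one]; rfl
  map_mul' g h := by rw [groupAlgebraAction_mul]; rfl

theorem isSemilinear_groupAlgebraRep (θ : (E ≃ₐ[K] E) →* MulAut M) :
    IsSemilinear (groupAlgebraRep θ) := by
  intro g c x
  change groupAlgebraAction θ g (c • x) = g c • groupAlgebraAction θ g x
  induction x using MonoidAlgebra.induction_linear with
  | zero => simp only [smul_zero, map_zero]
  | add x y hx hy => simp only [smul_add, map_add, hx, hy]
  | single η d => simp [groupAlgebraAction_single]

/-- The restriction to `E[M]^G` of the `E`-algebra homomorphism given by a character of `M`. -/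
def fixedEval (θ : (E ≃ₐ[K] E) →* MulAut M) (χ : M →* Eˣ) : fixedAlgebra θ →ₐ[K] E :=
  ((charEval χ).restrictScalars K).comp (fixedAlgebra θ).val

theorem fixedEval_dualAction (θ : (E ≃ₐ[K] E) →* MulAut M) (g : E ≃ₐ[K] E) (χ : M →* Eˣ) :
    fixedEval θ (dualAction θ g χ) = (g : E →ₐ[K] E).comp (fixedEval θ χ) := by
  ext x
  have h := charEval_dualAction θ g χ x
  rwa [x.2 g] at h

variable [FiniteDimensional K E] [IsGalois K E]

theorem isBaseChange_fixedAlgebra (θ : (E ≃ₐ[K] E) →* MulAut M) :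
    IsBaseChange E (fixedAlgebra θ).val.toLinearMap :=
  (isSemilinear_groupAlgebraRep θ).isBaseChange_invariants

/-- Scalar extension from `K` to `E` turns `E[M]^G` into `E[M]`. -/
def fixedAlgebraBaseChange (θ : (E ≃ₐ[K] E) →* MulAut M) :
    E ⊗[K] fixedAlgebra θ ≃ₐ[E] MonoidAlgebra E M :=
  Algebra.TensorProduct.algEquivOfLinearEquivTensorProduct (isBaseChange_fixedAlgebra θ).equiv
    (fun c d x y => by simp [IsBaseChange.equiv_tmul, mul_comm c d, mul_smul])
    (by simp [IsBaseChange.equiv_tmul])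

theorem fixedEval_bijective (θ : (E ≃ₐ[K] E) →* MulAut M) : Function.Bijective (fixedEval θ) := by
  have hcomp : fixedEval θ = (AlgHom.liftEquiv K E (fixedAlgebra θ) E).symm ∘
      ((fixedAlgebraBaseChange θ).arrowCongr AlgEquiv.refl).symm ∘ charEval := by
    funext χ
    ext x
    simp [fixedEval, fixedAlgebraBaseChange, IsBaseChange.equiv_tmul]
  rw [hcomp]
  exact (Equiv.bijective _).comp ((Equiv.bijective _).comp (charEval_bijective E M))

theorem dualAction_gSetIso_of_algEquiv {θ : (E ≃ₐ[K] E) →* MulAut M}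
    {θ' : (E ≃ₐ[K] E) →* MulAut M'} (σ : fixedAlgebra θ ≃ₐ[K] fixedAlgebra θ') :
    GSetIso (dualAction θ) (dualAction θ') := by
  let e := Equiv.ofBijective _ (fixedEval_bijective θ)
  let e' := Equiv.ofBijective _ (fixedEval_bijective θ')
  let f := (e.trans (σ.arrowCongr AlgEquiv.refl)).trans e'.symm
  have hf (χ) : fixedEval θ' (f χ) = (fixedEval θ χ).comp σ.symm :=
    e'.apply_symm_apply _
  refine ⟨f, fun g χ => e'.injective ?_⟩
  change fixedEval θ' _ = fixedEval θ' _
  rw [hf, fixedEval_dualAction, fixedEval_dualAction, hf, AlgHom.comp_assoc]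

end FixedAlgebra

section EquivariantFunctions

variable {K E M M' : Type*} [Field K] [Field E] [Algebra K E] [Group M] [Group M']

/-- The `K`-algebra of `Gal(E/K)`-equivariant functions from a `Gal(E/K)`-set to `E`. -/
def equivariantFunctions {X : Type*} (a : (E ≃ₐ[K] E) →* Equiv.Perm X) : Subalgebra K (X → E) where
  carrier := {φ | ∀ g x, φ (a g x) = g (φ x)}
  mul_mem' hφ hψ g x := by simp only [Pi.mul_apply, hφ g x, hψ g x, map_mul]
  add_mem' hφ hψ g x := by simp only [Pi.add_apply, hφ g x, hψ g x, map_add]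
  algebraMap_mem' r g _ := (g.commutes r).symm

theorem nonempty_algEquiv_of_mem_iff {A B : Type*} [Semiring A] [Semiring B] [Algebra K A]
    [Algebra K B] {S : Subalgebra K A} {T : Subalgebra K B} (e : A ≃ₐ[K] B)
    (h : ∀ x, e x ∈ T ↔ x ∈ S) : Nonempty (S ≃ₐ[K] T) := by
  have hmap : S.map (e : A →ₐ[K] B) = T := by
    ext y
    obtain ⟨x, rfl⟩ := e.surjective y
    simp [h]
  exact ⟨(e.subalgebraMap S).trans (Subalgebra.equivOfEq _ _ hmap)⟩

theorem GSetIso.nonempty_equivariantFunctions_algEquiv {X Y : Type*}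
    {a : (E ≃ₐ[K] E) →* Equiv.Perm X} {b : (E ≃ₐ[K] E) →* Equiv.Perm Y} (h : GSetIso a b) :
    Nonempty (equivariantFunctions a ≃ₐ[K] equivariantFunctions b) := by
  obtain ⟨f, hf⟩ := h
  let e : (X → E) ≃ₐ[K] (Y → E) := AlgEquiv.piCongrLeft' K (fun _ => E) f
  have he (φ : X → E) (x : X) : e φ (f x) = φ x := congrArg φ (f.symm_apply_apply x)
  refine nonempty_algEquiv_of_mem_iff e fun φ => forall_congr' fun g => ?_
  rw [f.surjective.forall]
  simp only [← hf, he]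

/-- The `E`-algebra homomorphism `E[M] → E^M̂` evaluating at all characters of `M`. -/
def charTransform (E M : Type*) [Field E] [Group M] : MonoidAlgebra E M →ₐ[E] (M →* Eˣ) → E :=
  AlgHom.pi charEval

theorem charTransform_apply (x : MonoidAlgebra E M) (χ : M →* Eˣ) :
    charTransform E M x χ = charEval χ x := rfl

theorem linearIndependent_characters (E M : Type*) [Field E] [Group M] :
    LinearIndependent E fun (χ : M →* Eˣ) (η : M) => (χ η : E) :=
  (linearIndependent_monoidHom M E).comp (fun χ : M →* Eˣ => (Units.coeHom E).comp χ)
    fun _ _ h => MonoidHom.ext fun η => Units.ext (DFunLike.congr_fun h η)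

theorem charTransform_surjective (E M : Type*) [Field E] [Group M] [Finite (M →* Eˣ)] :
    Function.Surjective (charTransform E M) := by
  change Function.Surjective (charTransform E M).toLinearMap
  rw [← LinearMap.range_eq_top, ← top_le_iff,
    ← span_flip_eq_top_iff_linearIndependent.mpr (linearIndependent_characters E M),
    Submodule.span_le]
  rintro _ ⟨η, rfl⟩
  exact ⟨MonoidAlgebra.single η 1, funext fun χ => (charEval_single χ η 1).trans (one_mul _)⟩

theorem charTransform_bijective [Finite M] (hM : Nat.card (M →* Eˣ) = Nat.card M) :
    Function.Bijective (charTransform E M) := by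
  have : Finite (M →* Eˣ) := Nat.finite_of_card_ne_zero (hM ▸ Nat.card_pos.ne')
  cases nonempty_fintype M
  cases nonempty_fintype (M →* Eˣ)
  let toFinsupp := MonoidAlgebra.coeffLinearEquiv (S := E) (M := M) E
  have : FiniteDimensional E (MonoidAlgebra E M) := Module.Finite.equiv toFinsupp.symm
  have hrank : Module.finrank E (MonoidAlgebra E M) = Module.finrank E ((M →* Eˣ) → E) := by
    rw [toFinsupp.finrank_eq, Module.finrank_finsupp_self, Module.finrank_pi,
      ← Nat.card_eq_fintype_card, ← Nat.card_eq_fintype_card, hM]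
  have hsurj := charTransform_surjective E M
  exact ⟨(LinearMap.injective_iff_surjective_of_finrank_eq_finrank hrank
    (f := (charTransform E M).toLinearMap)).mpr hsurj, hsurj⟩

theorem charTransform_mem_equivariantFunctions_iff
    (hinj : Function.Injective (charTransform E M)) (θ : (E ≃ₐ[K] E) →* MulAut M)
    (x : MonoidAlgebra E M) :
    charTransform E M x ∈ equivariantFunctions (dualAction θ) ↔ x ∈ fixedAlgebra θ := by
  refine forall_congr' fun g => ?_
  rw [eq_comm (b := x), ← hinj.eq_iff, funext_iff, iff_comm, (dualAction θ g).surjective.forall]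
  simp only [charTransform_apply, charEval_dualAction]

theorem nonempty_fixedAlgebra_algEquiv_equivariantFunctions [Finite M]
    (hM : Nat.card (M →* Eˣ) = Nat.card M) (θ : (E ≃ₐ[K] E) →* MulAut M) :
    Nonempty (fixedAlgebra θ ≃ₐ[K] equivariantFunctions (dualAction θ)) :=
  have hbij := charTransform_bijective (E := E) hM
  nonempty_algEquiv_of_mem_iff ((AlgEquiv.ofBijective _ hbij).restrictScalars K)
    (charTransform_mem_equivariantFunctions_iff hbij.1 θ)

theorem nonempty_fixedAlgebra_algEquiv_iff [FiniteDimensional K E] [IsGalois K E] [Finite M]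
    [Finite M'] (hM : Nat.card (M →* Eˣ) = Nat.card M) (hM' : Nat.card (M' →* Eˣ) = Nat.card M')
    (θ : (E ≃ₐ[K] E) →* MulAut M) (θ' : (E ≃ₐ[K] E) →* MulAut M') :
    Nonempty (fixedAlgebra θ ≃ₐ[K] fixedAlgebra θ') ↔
      GSetIso (dualAction θ) (dualAction θ') := by
  refine ⟨fun ⟨σ⟩ => dualAction_gSetIso_of_algEquiv σ, fun h => ?_⟩
  obtain ⟨e⟩ := nonempty_fixedAlgebra_algEquiv_equivariantFunctions hM θ
  obtain ⟨e'⟩ := nonempty_fixedAlgebra_algEquiv_equivariantFunctions hM' θ'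
  obtain ⟨f⟩ := h.nonempty_equivariantFunctions_algEquiv
  exact ⟨(e.trans f).trans e'.symm⟩

end EquivariantFunctions

section CyclicDuality

variable {K F M M' : Type*} [Field K] [Field F] [Group M] [Finite M] [Group M'] [Finite M']

theorem nonempty_mulEquiv_characters [IsCyclic M] {ζ : F} (hζ : IsPrimitiveRoot ζ (Nat.card M)) :
    Nonempty (M ≃* (M →* Fˣ)) := by
  let : CommGroup M := IsCyclic.commGroup
  have : NeZero (Nat.card M) := ⟨Nat.card_pos.ne'⟩
  have : HasEnoughRootsOfUnity F (Nat.card M) := ⟨⟨ζ, hζ⟩, inferInstance⟩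
  exact (IsCyclic.monoidHom_equiv_self M F).map MulEquiv.symm

theorem card_characters [IsCyclic M] {ζ : F} (hζ : IsPrimitiveRoot ζ (Nat.card M)) :
    Nat.card (M →* Fˣ) = Nat.card M :=
  have ⟨e⟩ := nonempty_mulEquiv_characters hζ
  (Nat.card_congr e.toEquiv).symm

variable [Algebra K F]

theorem character_mem_range_algebraMap {ζ : K} (hζ : IsPrimitiveRoot ζ (Nat.card M))
    (χ : M →* Fˣ) (x : M) : (χ x : F) ∈ (algebraMap K F).range := by
  have : NeZero (Nat.card M) := ⟨Nat.card_pos.ne'⟩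
  have hpow : (χ x : F) ^ Nat.card M = 1 := by
    rw [← Units.val_pow_eq_pow_val, ← map_pow, pow_card_eq_one', map_one, Units.val_one]
  obtain ⟨i, -, hi⟩ :=
    (hζ.map_of_injective (algebraMap K F).injective).eq_pow_of_pow_eq_one hpow
  exact ⟨ζ ^ i, by rw [map_pow, hi]⟩

theorem dualAction_mulEquiv_apply [IsCyclic M] {ζ : K} (hζ : IsPrimitiveRoot ζ (Nat.card M))
    (θ : (F ≃ₐ[K] F) →* MulAut M) (e : M ≃* (M →* Fˣ)) (γ : F ≃ₐ[K] F) (x : M) :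
    dualAction θ γ (e x) = e (θ γ⁻¹ x) := by
  -- `θ γ⁻¹` is a power map, so it may be moved from the argument of `e x` to `x`.
  obtain ⟨m, hm⟩ := MonoidHom.map_cyclic (θ γ⁻¹).toMonoidHom
  replace hm (y : M) : θ γ⁻¹ y = y ^ m := hm y
  ext y
  obtain ⟨c, hc⟩ := character_mem_range_algebraMap hζ (e x) (θ γ⁻¹ y)
  rw [dualAction_apply, ← hc, γ.commutes, hc, hm, hm, map_zpow, map_zpow, MonoidHom.zpow_apply]

theorem dualAction_gSetIso_iff_toGSet_gSetIso [IsCyclic M] [IsCyclic M'] {ζ : K}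
    (hζ : IsPrimitiveRoot ζ (Nat.card M)) (hcard : Nat.card M = Nat.card M')
    (θ : (F ≃ₐ[K] F) →* MulAut M) (θ' : (F ≃ₐ[K] F) →* MulAut M') :
    GSetIso (dualAction θ) (dualAction θ') ↔ GSetIso (toGSet θ) (toGSet θ') := by
  have hζ' := hcard ▸ hζ
  obtain ⟨e⟩ := nonempty_mulEquiv_characters (hζ.map_of_injective (algebraMap K F).injective)
  obtain ⟨e'⟩ := nonempty_mulEquiv_characters (hζ'.map_of_injective (algebraMap K F).injective)
  refine (GSetIso.congr_inv e.toEquiv e'.toEquiv (fun γ x => ?_) (fun γ x => ?_)).symm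
  · exact dualAction_mulEquiv_apply hζ θ e γ x
  · exact dualAction_mulEquiv_apply hζ' θ' e' γ x

end CyclicDuality

section ByottTranslation

theorem leftReg_holProj {N : Type*} [Group N] (h : Hol N) (η : N) :
    leftReg N (holProj N h η) = h * leftReg N η * (h : Equiv.Perm N)⁻¹ := by
  ext x
  calc h.1 η * (h.1 1)⁻¹ * x = h.1 η * (h.1 1)⁻¹ * h.1 (h.1⁻¹ x) := by simp
    _ = h.1 (η * h.1⁻¹ x) := (hol_apply_mul h.2 η _).symm

namespace RegularEmbedding

variable {K E : Type*} [Field K] [Field E] [Algebra K E] [FiniteDimensional K E]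
  {L : IntermediateField K E} {N : Type*} [Group N] (α : RegularEmbedding L N)

theorem permCongr_translationPerm (g : E ≃ₐ[K] E) :
    α.evalEquiv.permCongrHom (α.translationPerm g) = cosetTranslation L g := by
  ext x
  simp [Equiv.permCongrHom, translationPerm_apply]

theorem hom_betaBar (g : E ≃ₐ[K] E) (η : N) :
    α.hom (α.betaBar g η) = cosetTranslation L g * α.hom η * (cosetTranslation L g)⁻¹ := by
  have hconj : leftReg N (α.betaBar g η) =
      α.translationPerm g * leftReg N η * (α.translationPerm g)⁻¹ :=
    leftReg_holProj (α.beta g) η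
  rw [← permCongr_leftReg, hconj, map_mul, map_mul, map_inv, permCongr_leftReg,
    permCongr_translationPerm]

theorem toGSet_betaBar_gSetIso : GSetIso (toGSet α.betaBar) (toGSet α.conjAction) :=
  ⟨(MonoidHom.ofInjective α.injective).toEquiv, fun g η => Subtype.ext (α.hom_betaBar g η)⟩

end RegularEmbedding

end ByottTranslation

section Inflation

open Polynomial

variable {K E F : Type*} [Field K] [Field E] [Field F] [Algebra K E] [Algebra K F]
  [Algebra E F] [IsScalarTower K E F] [Normal K E]

theorem toGSet_inflate_gSetIso_iff {M M' : Type*} [Group M] [Group M'] [Normal K F]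
    (θ : (E ≃ₐ[K] E) →* MulAut M) (θ' : (E ≃ₐ[K] E) →* MulAut M') :
    GSetIso (toGSet (inflate F θ)) (toGSet (inflate F θ')) ↔ GSetIso (toGSet θ) (toGSet θ') :=
  GSetIso.comp_iff (a := toGSet θ) (b := toGSet θ')
    (AlgEquiv.restrictNormalHom_surjective (F := K) (K₁ := E) F)

theorem splits_minpoly_of_pow_eq_one {ζ b : F} {n : ℕ} (hζ : IsPrimitiveRoot ζ n) (hn : n ≠ 0)
    (hb : b ^ n = 1) : ((minpoly K b).map (algebraMap K F)).Splits := by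
  have hdvd : (minpoly K b).map (algebraMap K F) ∣ X ^ n - 1 := by
    have hmin : minpoly K b ∣ X ^ n - 1 := minpoly.dvd K b (by simp [hb])
    simpa only [Polynomial.map_sub, Polynomial.map_pow, map_X, Polynomial.map_one]
      using Polynomial.map_dvd (algebraMap K F) hmin
  exact (X_pow_sub_one_splits hζ).of_dvd (monic_X_pow_sub_C 1 hn).ne_zero hdvd

variable (K E F) in
theorem normal_of_adjoin_eq_top {T : Set F} (hT : Algebra.adjoin E T = ⊤)
    (hsplits : ∀ b ∈ T, IsIntegral K b ∧ ((minpoly K b).map (algebraMap K F)).Splits) :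
    Normal K F := by
  have hrange (c : E) : IsIntegral K (algebraMap E F c) ∧
      ((minpoly K (algebraMap E F c)).map (algebraMap K F)).Splits := by
    have hc := (Normal.splits (F := K) inferInstance c).map (algebraMap E F)
    rw [Polynomial.map_map, ← IsScalarTower.algebraMap_eq] at hc
    rw [minpoly.algebraMap_eq (algebraMap E F).injective]
    exact ⟨(Normal.isIntegral inferInstance c).algebraMap, hc⟩
  have hgen : ∀ b ∈ Set.range (algebraMap E F) ∪ T,
      IsIntegral K b ∧ ((minpoly K b).map (algebraMap K F)).Splits := by
    rintro b (⟨c, rfl⟩ | hb)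
    exacts [hrange c, hsplits b hb]
  have htop (x : F) : x ∈ IntermediateField.adjoin K (Set.range (algebraMap E F) ∪ T) := by
    have hx : x ∈ Algebra.adjoin E T := hT ▸ Algebra.mem_top
    induction hx using Algebra.adjoin_induction with
    | mem b hb => exact IntermediateField.subset_adjoin _ _ (.inr hb)
    | algebraMap c => exact IntermediateField.subset_adjoin _ _ (.inl ⟨c, rfl⟩)
    | add _ _ _ _ hx hy => exact add_mem hx hy
    | mul _ _ _ _ hx hy => exact mul_mem hx hy
  have halg := IntermediateField.isAlgebraic_adjoin fun b hb => (hgen b hb).1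
  refine normal_iff.mpr fun x => ⟨?_, IntermediateField.splits_of_mem_adjoin K F hgen (htop x)⟩
  exact (IntermediateField.isAlgebraic_iff.mp (halg.isAlgebraic ⟨x, htop x⟩)).isIntegral

variable (K E F) in
theorem normal_of_isCyclotomicExtension (S : Set ℕ) [IsCyclotomicExtension S E F] :
    Normal K F := by
  refine normal_of_adjoin_eq_top K E F
    ((IsCyclotomicExtension.iff_adjoin_eq_top S E F).mp inferInstance).2 ?_
  rintro b ⟨n, hn, hn0, hb⟩
  obtain ⟨ζ, hζ⟩ := IsCyclotomicExtension.exists_isPrimitiveRoot E F hn hn0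
  exact ⟨.of_pow hn0.bot_lt (hb ▸ isIntegral_one), splits_minpoly_of_pow_eq_one hζ hn0 hb⟩

end Inflation

end

end HopfGalois

open HopfGalois in
theorem mainTheorem6_general {K E F : Type*} [Field K] [Field E] [Algebra K E]
    [FiniteDimensional K E] [IsGalois K E] {L : IntermediateField K E} {N : Type*} [Group N]
    [IsCyclic N] [Field F] [Algebra K F] [Algebra E F] [IsScalarTower K E F] [Normal K F]
    (hζ : ∃ ζ : K, IsPrimitiveRoot ζ (Nat.card N)) (α₁ α₂ : RegularEmbedding L N) :
    List.TFAE
      [Nonempty (fixedAlgebra α₁.conjAction ≃ₐ[K] fixedAlgebra α₂.conjAction),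
        GSetIso (dualAction (inflate F α₁.conjAction)) (dualAction (inflate F α₂.conjAction)),
        GSetIso (dualAction (inflate F α₁.betaBar)) (dualAction (inflate F α₂.betaBar)),
        GSetIso (toGSet (inflate F α₁.conjAction)) (toGSet (inflate F α₂.conjAction)),
        GSetIso (toGSet (inflate F α₁.betaBar)) (toGSet (inflate F α₂.betaBar))] := by
  obtain ⟨ζ, hζ⟩ := hζ
  let e (α : RegularEmbedding L N) : N ≃* α.image := MonoidHom.ofInjective α.injective
  have hfin : Finite N := .of_equiv _ α₁.evalEquiv.symm
  have (α : RegularEmbedding L N) : Finite α.image := .of_equiv _ (e α).toEquiv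
  have (α : RegularEmbedding L N) : IsCyclic α.image := (e α).isCyclic.mp ‹_›
  have hζ' (α : RegularEmbedding L N) : IsPrimitiveRoot ζ (Nat.card α.image) :=
    Nat.card_congr (e α).toEquiv ▸ hζ
  have hcard : Nat.card α₁.image = Nat.card α₂.image :=
    Nat.card_congr ((e α₁).symm.trans (e α₂)).toEquiv
  have hchar (α : RegularEmbedding L N) : Nat.card (α.image →* Eˣ) = Nat.card α.image :=
    card_characters ((hζ' α).map_of_injective (algebraMap K E).injective)
  tfae_have 2 ↔ 4 := dualAction_gSetIso_iff_toGSet_gSetIso (hζ' α₁) hcard _ _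
  tfae_have 3 ↔ 5 := dualAction_gSetIso_iff_toGSet_gSetIso hζ rfl _ _
  tfae_have 4 ↔ 5 := by
    rw [toGSet_inflate_gSetIso_iff, toGSet_inflate_gSetIso_iff]
    exact (GSetIso.congr α₁.toGSet_betaBar_gSetIso α₂.toGSet_betaBar_gSetIso).symm
  tfae_have 1 ↔ 4 := by
    rw [nonempty_fixedAlgebra_algEquiv_iff (hchar α₁) (hchar α₂), toGSet_inflate_gSetIso_iff]
    exact dualAction_gSetIso_iff_toGSet_gSetIso (hζ' α₁) hcard _ _
  tfae_finish

/-- `E / K` is the Galois closure of `L / K`, `F = Ẽ` is the compositum of `E` and `K(ζ_e)`, where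
`e` is the exponent of `N`, and `Γ = Gal(F/K)`. -/
theorem mainTheorem6 {K E F : Type*} [Field K] [CharZero K] [Field E] [Algebra K E]
    [FiniteDimensional K E] [IsGalois K E]
    (L : IntermediateField K E) [IsNormalClosure K L E]
    {N : Type*} [Group N] [IsCyclic N]
    [Field F] [Algebra K F] [Algebra E F] [IsScalarTower K E F]
    [IsCyclotomicExtension {Monoid.exponent N} E F]
    (hζ : ∃ ζ : K, IsPrimitiveRoot ζ (Nat.card N))
    (α₁ α₂ : HopfGalois.RegularEmbedding L N) :
    List.TFAE
      [Nonempty (HopfGalois.fixedAlgebra α₁.conjAction ≃ₐ[K]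
          HopfGalois.fixedAlgebra α₂.conjAction),
        HopfGalois.GSetIso
          (HopfGalois.dualAction (HopfGalois.inflate F α₁.conjAction))
          (HopfGalois.dualAction (HopfGalois.inflate F α₂.conjAction)),
        HopfGalois.GSetIso
          (HopfGalois.dualAction (HopfGalois.inflate F α₁.betaBar))
          (HopfGalois.dualAction (HopfGalois.inflate F α₂.betaBar)),
        HopfGalois.GSetIso
          (HopfGalois.toGSet (HopfGalois.inflate F α₁.conjAction))
          (HopfGalois.toGSet (HopfGalois.inflate F α₂.conjAction)),
        HopfGalois.GSetIso
          (HopfGalois.toGSet (HopfGalois.inflate F α₁.betaBar))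
          (HopfGalois.toGSet (HopfGalois.inflate F α₂.betaBar))] := by
  have := HopfGalois.normal_of_isCyclotomicExtension K E F {Monoid.exponent N}
  exact mainTheorem6_general hζ α₁ α₂
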